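/- Let $\mathbf F_q$ be a finite field, $A=\mathbf F_q[T]$, $K=\mathbf F_q(T)$, let $L$ be a finite extension of $\mathbf F_q$ with an $\mathbf F_q$-algebra homomorphism $\gamma:A\to L$, and let $P=\ker\gamma$. Let $L\{\tau\}$ be the ring of Ore polynomials, with $\tau\lambda=\lambda^q\tau$ for $\lambda\in L$. Let $\Phi:A\to L\{\tau\}$ be a Drinfeld $A$-module of rank $2$ over $L$, that is, an $\mathbf F_q$-algebra homomorphism such that $\Phi_a$ has constant term $\gamma(a)$ for all $a\in A$ and $\Phi_T=a_1+a_2\tau+a_3\tau^2$ with $a_3\neq0$. Assume that $\Phi$ is ordinary, i.e. $\Phi[P](\overline L)\neq 0$. Let $L^\Phi$ be $L$ with the $A$-module structure $a\cdot x=\Phi_a(x)$, and let $\mathrm{End}_L\Phi$ be the ring of all $f\in L\{\tau\}$ with $f\Phi_a=\Phi_a f$ for all $a\in A$. Let $F=\tau^{[L:\mathbf F_q]}$ be the Frobenius of $L$ and let $P_\Phi(X)=X^2-cX+N$ with $c,N\in A$ be its characteristic polynomial (so for every ideal $I$ of $A$ prime to $P$, $F$ acts on the free $A/I$-module $\Phi[I](\overline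 L)$ of rank $2$ with characteristic polynomial $P_\Phi \bmod I$). Put $\Delta=c^2-4N$. Let $\rho\neq A$ be an ideal of $A$, different from $P$, such that $\rho^2\mid P_\Phi(1)$ and $\rho\mid c-2$. Let $O(\Delta/\rho^2)$ be the $A$-order of the quadratic field $K(F)\subset K\otimes_A\mathrm{End}_L\Phi$ whose discriminant is the ideal $\Delta\rho^{-2}$ of $A$. If $O(\Delta/\rho^2)\subset\mathrm{End}_L\Phi$, then the $A$-module $L^\Phi$ is not cyclic. -/

import Mathlib

open Polynomial TensorProduct

noncomputable section

/-! ## The Ore polynomial ring `L{τ}` -/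

section Ore

variable (Fq L : Type*) [Field Fq] [Fintype Fq] [Field L] [Algebra Fq L]

/-- The `q`-power Frobenius `x ↦ x ^ q` of an `𝔽_q`-algebra `E`, as an additive endomorphism. -/
def qFrob (E : Type*) [CommRing E] [Algebra Fq E] : AddMonoid.End E :=
  (FiniteField.frobeniusAlgHom Fq E).toRingHom.toAddMonoidHom

theorem qFrob_pow_apply {E : Type*} [CommRing E] [Algebra Fq E] (n : ℕ) (x : E) :
    (qFrob Fq E ^ n) x = x ^ Fintype.card Fq ^ n := by
  induction n generalizing x with
  | zero => simp
  | succ n ih =>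
    rw [pow_succ]
    change (qFrob Fq E ^ n) (x ^ Fintype.card Fq) = _
    rw [ih]
    rw [← pow_mul, pow_succ']

/-- `n` acts on `L` by the `n`-th iterate of the `q`-power Frobenius, `x ↦ x ^ (q ^ n)`. -/
@[reducible] def frobAction : MulSemiringAction (Multiplicative ℕ) L where
  smul n x := x ^ Fintype.card Fq ^ n.toAdd
  one_smul x := by change x ^ Fintype.card Fq ^ 0 = x; simp
  mul_smul m n x := by
    change x ^ Fintype.card Fq ^ (m.toAdd + n.toAdd) =
      (x ^ Fintype.card Fq ^ n.toAdd) ^ Fintype.card Fq ^ m.toAdd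
    rw [← pow_mul, ← pow_add, add_comm]
  smul_zero n := by
    change (0 : L) ^ Fintype.card Fq ^ n.toAdd = 0
    rw [← qFrob_pow_apply, map_zero]
  smul_add n x y := by
    change (x + y) ^ Fintype.card Fq ^ n.toAdd =
      x ^ Fintype.card Fq ^ n.toAdd + y ^ Fintype.card Fq ^ n.toAdd
    simp only [← qFrob_pow_apply, map_add]
  smul_one n := by change (1 : L) ^ Fintype.card Fq ^ n.toAdd = 1; simp
  smul_mul n x y := by
    change (x * y) ^ Fintype.card Fq ^ n.toAdd =
      x ^ Fintype.card Fq ^ n.toAdd * y ^ Fintype.card Fq ^ n.toAdd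
    rw [mul_pow]

/-- The Ore polynomial ring `L{τ}`, in which `τ * λ = λ ^ q * τ` for `λ ∈ L`. -/
@[nolint unusedArguments]
def Ore (_Fq L : Type*) [Field L] : Type _ := SkewPolynomial L

instance : Ring (Ore Fq L) :=
  letI := frobAction Fq L
  inferInstanceAs (Ring (SkewMonoidAlgebra L (Multiplicative ℕ)))

variable {L}

/-- The element `a τ ^ n` of `L{τ}`. -/
def Ore.monomial (n : ℕ) (a : L) : Ore Fq L := SkewPolynomial.monomial n a

variable {Fq}

/-- The coefficient of `τ ^ n`. -/
def Ore.coeff (f : Ore Fq L) (n : ℕ) : L := SkewPolynomial.coeff (R := L) f n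

theorem Ore.monomial_mul_monomial (m n : ℕ) (a b : L) :
    Ore.monomial Fq m a * Ore.monomial Fq n b =
      Ore.monomial Fq (m + n) (a * b ^ Fintype.card Fq ^ m) :=
  letI := frobAction Fq L
  SkewMonoidAlgebra.single_mul_single (k := L) (G := Multiplicative ℕ)

variable (Fq)

/-- `L{τ}` acts on every commutative `L`-algebra `E`: the element `∑ aᵢ τ ^ i` sends `x` to
`∑ aᵢ x ^ (q ^ i)`. -/
def Ore.act (E : Type*) [CommRing E] [Algebra L E] [Algebra Fq E] :
    Ore Fq L →+* AddMonoid.End E :=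
  letI := frobAction Fq L
  SkewMonoidAlgebra.liftNCRingHom (k := L) (G := Multiplicative ℕ)
    (Module.toAddMonoidEnd L E) (powersHom _ (qFrob Fq E)) (by
      intro a n
      ext x
      change (a ^ Fintype.card Fq ^ n.toAdd) • (qFrob Fq E ^ n.toAdd) x =
        (qFrob Fq E ^ n.toAdd) (a • x)
      rw [qFrob_pow_apply, qFrob_pow_apply, _root_.smul_pow])

theorem Ore.act_monomial (E : Type*) [CommRing E] [Algebra L E] [Algebra Fq E] (n : ℕ) (a : L)
    (x : E) : Ore.act Fq E (Ore.monomial Fq n a) x = a • x ^ Fintype.card Fq ^ n := by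
  let _ := frobAction Fq L
  have h : Ore.act Fq E (Ore.monomial Fq n a) =
      Module.toAddMonoidEnd L E a * powersHom _ (qFrob Fq E) (Multiplicative.ofAdd n) :=
    SkewMonoidAlgebra.liftNC_single (k := L) (G := Multiplicative ℕ) _ _ _ _
  rw [h]
  change a • (qFrob Fq E ^ n) x = _
  rw [qFrob_pow_apply]

variable (L)

/-- The Frobenius of the finite field `L` as an element of `L{τ}`: `F = τ ^ n`, `n = [L : 𝔽_q]`. -/
def Ore.frob : Ore Fq L := Ore.monomial Fq (Module.finrank Fq L) 1

theorem Ore.frob_mul [Finite L] (f : Ore Fq L) : Ore.frob Fq L * f = f * Ore.frob Fq L := by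
  have key : ∀ (n : ℕ) (a : L),
      Ore.frob Fq L * Ore.monomial Fq n a = Ore.monomial Fq n a * Ore.frob Fq L := by
    intro n a
    have hc : a ^ Fintype.card Fq ^ Module.finrank Fq L = a := by
      have := Fintype.ofFinite L
      rw [← Module.card_eq_pow_finrank (K := Fq) (V := L), FiniteField.pow_card]
    rw [Ore.frob, Ore.monomial_mul_monomial, Ore.monomial_mul_monomial, hc]
    simp [add_comm]
  refine SkewPolynomial.induction (R := L)
    (motive := fun g : Ore Fq L => Ore.frob Fq L * g = g * Ore.frob Fq L) f ?_ ?_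
  · exact (mul_zero (Ore.frob Fq L)).trans (zero_mul (Ore.frob Fq L)).symm
  · intro n a g _ _ hg
    exact (mul_add (Ore.frob Fq L) (Ore.monomial Fq n a) g).trans
      ((congrArg₂ (· + ·) (key n a) hg).trans
        (add_mul (Ore.monomial Fq n a) g (Ore.frob Fq L)).symm)

end Ore

/-! ## Drinfeld modules of rank 2 over `A = 𝔽_q[T]` -/

/-- A Drinfeld `𝔽_q[T]`-module of rank 2 over the `A`-field `(L, γ)`: a homomorphism
`Φ : 𝔽_q[T] → L{τ}` of `𝔽_q`-algebras such that `Φ_a` has constant term `γ a` and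
`Φ_T = a₁ + a₂ τ + a₃ τ ^ 2` with `a₃ ≠ 0`. -/
structure DrinfeldModule {Fq L : Type*} [Field Fq] [Fintype Fq] [Field L] [Algebra Fq L]
    (γ : Fq[X] →ₐ[Fq] L) where
  toRingHom : Fq[X] →+* Ore Fq L
  map_C : ∀ a : Fq, toRingHom (C a) = Ore.monomial Fq 0 (algebraMap Fq L a)
  coeff_zero : ∀ a : Fq[X], (toRingHom a).coeff 0 = γ a
  coeff_two_ne_zero : (toRingHom X).coeff 2 ≠ 0
  coeff_eq_zero : ∀ i : ℕ, 2 < i → (toRingHom X).coeff i = 0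

namespace DrinfeldModule

variable {Fq L : Type*} [Field Fq] [Fintype Fq] [Field L] [Algebra Fq L]
  {γ : Fq[X] →ₐ[Fq] L} (Φ : DrinfeldModule γ)

/-- The underlying additive group of the `A`-module that `Φ` defines on a commutative
`L`-algebra `E`. For `E = L` this is `L^Φ`. -/
@[nolint unusedArguments]
def Points (_Φ : DrinfeldModule γ) (E : Type*) : Type _ := E

section Points

variable (E : Type*) [CommRing E] [Algebra L E] [Algebra Fq E]

instance : AddCommGroup (Φ.Points E) := inferInstanceAs (AddCommGroup E)

/-- `a • x = Φ_a(x)`. -/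
instance : Module Fq[X] (Φ.Points E) :=
  letI : Module (AddMonoid.End E) (Φ.Points E) := inferInstanceAs (Module (AddMonoid.End E) E)
  Module.compHom (Φ.Points E) ((Ore.act Fq E).comp Φ.toRingHom)

theorem smul_def (a : Fq[X]) (x : Φ.Points E) :
    a • x = (Ore.act Fq E (Φ.toRingHom a) : AddMonoid.End E) x := rfl

end Points

/-- The endomorphism ring `End_L Φ`: all `f ∈ L{τ}` with `f Φ_a = Φ_a f` for every `a ∈ A`. -/
def endRing : Subring (Ore Fq L) := Subring.centralizer (Set.range Φ.toRingHom)

/-- `End_L Φ` is an `A`-algebra through `Φ`. -/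
instance : Algebra Fq[X] Φ.endRing :=
  RingHom.toAlgebra'
    (Φ.toRingHom.codRestrict Φ.endRing (by
      intro a
      rw [endRing, Subring.mem_centralizer_iff]
      rintro _ ⟨b, rfl⟩
      rw [← map_mul, ← map_mul, mul_comm]))
    (by
      rintro a ⟨f, hf⟩
      apply Subtype.ext
      exact (Subring.mem_centralizer_iff.mp hf _ ⟨a, rfl⟩))

section Frobenius

variable [Finite L]

/-- The Frobenius `F` of `L` as an endomorphism of `Φ`. -/
def frob : Φ.endRing :=
  ⟨Ore.frob Fq L, Subring.mem_centralizer_iff.mpr fun g _ => (Ore.frob_mul Fq L g).symm⟩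

/-- The Frobenius as an `A`-linear map `x ↦ x ^ (q ^ n)` on the points of `Φ` in `E`. -/
def frobPoints (E : Type*) [CommRing E] [Algebra L E] [Algebra Fq E] :
    Φ.Points E →ₗ[Fq[X]] Φ.Points E where
  toFun x := (Ore.act Fq E (Ore.frob Fq L) : AddMonoid.End E) x
  map_add' x y := map_add (Ore.act Fq E (Ore.frob Fq L) : AddMonoid.End E) x y
  map_smul' a x := by
    have h := congrArg (Ore.act Fq E) (Ore.frob_mul Fq L (Φ.toRingHom a))
    rw [map_mul, map_mul] at h
    exact DFunLike.congr_fun h x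

/-- The `I`-division points `Φ[I]` of `Φ` in an algebraic closure of `L`, an `A/I`-module. -/
abbrev torsion (I : Ideal Fq[X]) : Submodule Fq[X] (Φ.Points (AlgebraicClosure L)) :=
  Submodule.torsionBySet Fq[X] (Φ.Points (AlgebraicClosure L)) I

/-- The action of the Frobenius on `Φ[I]`, as an `A/I`-linear map. -/
def frobTorsion (I : Ideal Fq[X]) : Φ.torsion I →ₗ[Fq[X] ⧸ I] Φ.torsion I :=
  LinearMap.extendScalarsOfSurjective (S := Fq[X] ⧸ I) (Ideal.Quotient.mk_surjective (I := I))
    ((Φ.frobPoints (AlgebraicClosure L)).restrict (p := Φ.torsion I) (q := Φ.torsion I) (by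
      intro x hx
      rw [Submodule.mem_torsionBySet_iff] at hx ⊢
      intro a
      rw [← map_smul, hx a, map_zero]))

/-- `Q` is the characteristic polynomial of the Frobenius of `Φ`, i.e. its characteristic
polynomial on the Tate modules of `Φ`: for every ideal `I` of `A` prime to the characteristic
`P = ker γ`, the Frobenius acts on the `A/I`-module `Φ[I]` (which is free of rank 2)
with characteristic polynomial `Q mod I`. -/
def IsFrobCharpoly (Q : Fq[X][X]) : Prop :=
  ∀ I : Ideal Fq[X], IsCoprime I (RingHom.ker γ) →
    ∀ b : Module.Basis (Fin 2) (Fq[X] ⧸ I) (Φ.torsion I),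
      (LinearMap.toMatrix b b (Φ.frobTorsion I)).charpoly = Q.map (Ideal.Quotient.mk I)

/-- `Φ` is ordinary: it has non-trivial `P`-division points, `P = ker γ`. -/
def IsOrdinary : Prop := Φ.torsion (RingHom.ker γ) ≠ ⊥

/-- The `K`-algebra `K ⊗_A End_L Φ`, where `K = 𝔽_q(T)`. -/
def EndK : Type _ := FractionRing Fq[X] ⊗[Fq[X]] Φ.endRing

instance : Ring Φ.EndK := inferInstanceAs (Ring (FractionRing Fq[X] ⊗[Fq[X]] Φ.endRing))

instance : Algebra (FractionRing Fq[X]) Φ.EndK :=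
  inferInstanceAs (Algebra (FractionRing Fq[X]) (FractionRing Fq[X] ⊗[Fq[X]] Φ.endRing))

instance : Algebra Fq[X] Φ.EndK :=
  inferInstanceAs (Algebra Fq[X] (FractionRing Fq[X] ⊗[Fq[X]] Φ.endRing))

instance : IsScalarTower Fq[X] (FractionRing Fq[X]) Φ.EndK :=
  inferInstanceAs (IsScalarTower Fq[X] (FractionRing Fq[X])
    (FractionRing Fq[X] ⊗[Fq[X]] Φ.endRing))

/-- The canonical map `End_L Φ → K ⊗_A End_L Φ`, `f ↦ 1 ⊗ f`. -/
def endToEndK : Φ.endRing →ₐ[Fq[X]] Φ.EndK :=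
  Algebra.TensorProduct.includeRight (R := Fq[X]) (A := FractionRing Fq[X]) (B := Φ.endRing)

/-- The field `K(F)`: the subalgebra generated by the Frobenius `F` in `K ⊗_A End_L Φ`. -/
def FrobField : Type _ := Algebra.adjoin (FractionRing Fq[X]) {Φ.endToEndK Φ.frob}

instance : CommRing Φ.FrobField :=
  inferInstanceAs (CommRing (Algebra.adjoin (FractionRing Fq[X]) {Φ.endToEndK Φ.frob}))

instance : Algebra (FractionRing Fq[X]) Φ.FrobField :=
  inferInstanceAs (Algebra (FractionRing Fq[X])
    (Algebra.adjoin (FractionRing Fq[X]) {Φ.endToEndK Φ.frob}))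

instance : Algebra Fq[X] Φ.FrobField :=
  inferInstanceAs (Algebra Fq[X] (Algebra.adjoin (FractionRing Fq[X]) {Φ.endToEndK Φ.frob}))

instance : IsScalarTower Fq[X] (FractionRing Fq[X]) Φ.FrobField :=
  inferInstanceAs (IsScalarTower Fq[X] (FractionRing Fq[X])
    (Algebra.adjoin (FractionRing Fq[X]) {Φ.endToEndK Φ.frob}))

/-- The inclusion `K(F) → K ⊗_A End_L Φ`. -/
def fieldToEndK : Φ.FrobField →ₐ[FractionRing Fq[X]] Φ.EndK :=
  (Algebra.adjoin (FractionRing Fq[X]) {Φ.endToEndK Φ.frob}).val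

/-- `O` is an `A`-order of `K(F)`: a subring containing `A` that is finitely generated as an
`A`-module and spans `K(F)` over `K`. -/
def IsOrder (O : Subalgebra Fq[X] Φ.FrobField) : Prop :=
  (Subalgebra.toSubmodule O).FG ∧
    Submodule.span (FractionRing Fq[X]) (O : Set Φ.FrobField) = ⊤

/-- The ideal `D` is the discriminant of the quadratic `A`-order `O`, i.e. it is generated by the
discriminant of the trace form of `O` in an `A`-basis of `O`. -/
def HasDiscr (O : Subalgebra Fq[X] Φ.FrobField) (D : Ideal Fq[X]) : Prop :=
  ∃ b : Module.Basis (Fin 2) Fq[X] O, D = Ideal.span {Algebra.discr Fq[X] b}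

/-- The inclusion `O ⊂ End_L Φ`, both viewed inside `K ⊗_A End_L Φ`. -/
def ContainedInEnd (O : Subalgebra Fq[X] Φ.FrobField) : Prop :=
  ∀ x ∈ O, ∃ f : Φ.endRing, Φ.endToEndK f = Φ.fieldToEndK x

end Frobenius

end DrinfeldModule

end

/-!
Write `ρ = (r)`. The element `w = (F - 1) / r` of `K(F)` satisfies a monic quadratic equation over
`A`, because `r ∣ c - 2` and `r ^ 2 ∣ P_Φ(1)`, and `A[w]` has discriminant `Δ / r ^ 2`. If `Δ = 0`,
then `c, N ∈ P`, so `F ^ 2 = c F - N` vanishes on `Φ[P] ≠ 0`, although `F` is injective; hence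
`Δ ≠ 0`. The determinant of a basis of the order `O` with respect to `(1, w)` has as its square a
quotient of two equal nonzero discriminants, up to a unit, so it is itself a unit and Cramer's rule
gives `w ∈ O`. Thus `F - 1 = w Φ_r` with `w ∈ End_L Φ`. Comparing constant terms shows that `r` is
prime to `P`, so `Φ[r]` has `q ^ (2 deg r)` elements; they are fixed by `F`, hence lie in `L^Φ`.
But a finite cyclic `A`-module has at most `q ^ deg r` elements killed by `r`.
-/

theorem exists_irreducible_natDegree_eq (k : Type*) [Field k] [Finite k] {n : ℕ} (hn : n ≠ 0) :
    ∃ f : k[X], Irreducible f ∧ f.natDegree = n := by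
  obtain ⟨p, _⟩ := CharP.exists k
  have : Fact p.Prime := ⟨CharP.char_is_prime k p⟩
  have : NeZero n := ⟨hn⟩
  obtain ⟨α, hα⟩ := Field.exists_primitive_element k (FiniteField.Extension k p n)
  exact ⟨minpoly k α, minpoly.irreducible (Algebra.IsIntegral.isIntegral α),
    ((Field.primitive_element_iff_minpoly_natDegree_eq k α).mp hα).trans
      (FiniteField.finrank_extension k p n)⟩

theorem natCard_quotient_span_singleton {k : Type*} [Field k] {f : k[X]} (hf : f ≠ 0) :
    Nat.card (k[X] ⧸ Ideal.span {f}) = Nat.card k ^ f.natDegree := by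
  have : Module.Finite k (k[X] ⧸ Ideal.span {f}) := (AdjoinRoot.powerBasis hf).finite
  rw [Module.natCard_eq_pow_finrank (K := k), finrank_quotient_span_eq_natDegree]

theorem mem_range_algebraMap_of_pow_natCard_eq {k E : Type*} [Field k] [Finite k] [Field E]
    [Algebra k E] {x : E} (hx : x ^ Nat.card k = x) : x ∈ (algebraMap k E).range := by
  have := Fintype.ofFinite k
  have hsplits : (X ^ Nat.card k - X : k[X]).Splits := by
    simpa [Nat.card_eq_fintype_card] using (FiniteField.isSplittingField_sub k k).splits
  exact hsplits.mem_range_of_isRoot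
    (FiniteField.X_pow_card_sub_X_ne_zero k Finite.one_lt_card) (by simpa using sub_eq_zero.mpr hx)

theorem natCard_torsionBy_eq_natCard_quotient {R M : Type*} [CommRing R] [AddCommGroup M]
    [Module R M] [Finite M] (a : R) : Nat.card (Submodule.torsionBy R M a) =
      Nat.card (M ⧸ LinearMap.range (DistribSMul.toLinearMap R M a)) :=
  (AddSubgroup.index_range (f := (DistribSMul.toLinearMap R M a).toAddMonoidHom)).symm

theorem natCard_torsionBy_le_of_isPrincipal {R M : Type*} [CommRing R] [AddCommGroup M]
    [Module R M] [Finite M] (hM : (⊤ : Submodule R M).IsPrincipal) (a : R)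
    [Finite (R ⧸ Ideal.span {a})] :
    Nat.card (Submodule.torsionBy R M a) ≤ Nat.card (R ⧸ Ideal.span {a}) := by
  obtain ⟨g, hg⟩ := hM
  let aM := LinearMap.range (DistribSMul.toLinearMap R M a)
  let φ : (R ⧸ Ideal.span {a}) →ₗ[R] M ⧸ aM :=
    Submodule.liftQ (Ideal.span {a}) (aM.mkQ ∘ₗ LinearMap.toSpanSingleton R M g) <|
      (Ideal.span_singleton_le_iff_mem _).mpr ((Submodule.Quotient.mk_eq_zero aM).mpr ⟨g, rfl⟩)
  rw [natCard_torsionBy_eq_natCard_quotient]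
  refine Nat.card_le_card_of_surjective φ fun y => ?_
  obtain ⟨m, rfl⟩ := aM.mkQ_surjective y
  obtain ⟨s, rfl⟩ := Submodule.mem_span_singleton.mp (hg ▸ Submodule.mem_top : m ∈ _)
  exact ⟨Ideal.Quotient.mk _ s, rfl⟩

section QuadraticOrder

theorem discr_eq_of_sq_eq {R S : Type*} [CommRing R] [CommRing S] [Algebra R S]
    (B : Module.Basis (Fin 2) R S) {w : S} (hB : ⇑B = ![1, w]) {u v : R}
    (hw : w ^ 2 = u • w - v • 1) : Algebra.discr R B = u ^ 2 - 4 * v := by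
  have h0 : B 0 = 1 := congrFun hB 0
  have h1 : B 1 = w := congrFun hB 1
  have htrace (x y : R) : Algebra.trace R S (x • 1 + y • w) = 2 * x + u * y := by
    have e0 : (x • 1 + y • w) * B 0 = x • B 0 + y • B 1 := by simp [h0, h1]
    have e1 : (x • 1 + y • w) * B 1 = (-(y * v)) • B 0 + (x + y * u) • B 1 := by
      rw [h0, h1, add_mul, smul_mul_assoc, smul_mul_assoc, one_mul, ← pow_two, hw]
      module
    rw [Algebra.trace_eq_matrix_trace B, Matrix.trace_fin_two, Algebra.leftMulMatrix_eq_repr_mul,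
      Algebra.leftMulMatrix_eq_repr_mul, e0, e1]
    simp only [map_add, map_smul, B.repr_self, Finsupp.add_apply, Finsupp.smul_apply,
      Finsupp.single_apply, one_ne_zero, zero_ne_one, if_true, if_false, smul_eq_mul]
    ring
  have t1 : Algebra.trace R S 1 = 2 := by simpa using htrace 1 0
  have tw : Algebra.trace R S w = u := by simpa using htrace 0 1
  have tw2 : Algebra.trace R S (w * w) = u ^ 2 - 2 * v := by
    rw [← pow_two, show w ^ 2 = (-v) • 1 + u • w by rw [hw]; module, htrace]
    ring
  rw [Algebra.discr_def, Matrix.det_fin_two]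
  simp only [Algebra.traceMatrix_apply, Algebra.traceForm_apply, h0, h1, mul_one, one_mul, t1, tw,
    tw2]
  ring

theorem basis_det_comp_linearMap {A K M E ι : Type*} [CommRing A] [CommRing K] [Algebra A K]
    [AddCommGroup M] [Module A M] [AddCommGroup E] [Module A E] [Module K E] [IsScalarTower A K E]
    [Fintype ι] [DecidableEq ι] (b : Module.Basis ι A M) (W : Module.Basis ι K E) (f : M →ₗ[A] E)
    (x : ι → M) : W.det (f ∘ x) = W.det (f ∘ b) * algebraMap A K (b.det x) := by
  rw [W.det_apply, W.det_apply, b.det_apply, RingHom.map_det, ← Matrix.det_mul]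
  congr 1
  ext i j
  simp only [Matrix.mul_apply, RingHom.mapMatrix_apply, Matrix.map_apply,
    Module.Basis.toMatrix_apply, Function.comp_apply]
  conv_lhs => rw [← b.sum_repr (x j)]
  simp only [map_sum, map_smul, Finsupp.coe_finsetSum, Finset.sum_apply]
  refine Finset.sum_congr rfl fun k _ => ?_
  rw [← algebraMap_smul K, map_smul, Finsupp.smul_apply, smul_eq_mul, mul_comm]

open nonZeroDivisors

variable {A K E : Type*} [CommRing A] [Field K] [Algebra A K] [IsFractionRing A K]
  [CommRing E] [Algebra K E] [Algebra A E] [IsScalarTower A K E] {O : Subalgebra A E}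

theorem isLocalization_of_span_eq_top (hO : Submodule.span K (O : Set E) = ⊤) :
    IsLocalization (Algebra.algebraMapSubmonoid O A⁰) E where
  map_units := by
    rintro ⟨_, a, ha, rfl⟩
    change IsUnit (algebraMap A E a)
    rw [IsScalarTower.algebraMap_apply A K E]
    exact (IsLocalization.map_units K ⟨a, ha⟩).map (algebraMap K E)
  surj x := by
    obtain ⟨y, hy, s, rfl⟩ := (IsLocalization.mem_span_iff A⁰).mp
      (hO ▸ Submodule.mem_top : x ∈ Submodule.span K (O : Set E))
    have hyO : y ∈ O := (Submodule.span_le (p := Subalgebra.toSubmodule O)).mpr subset_rfl hy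
    refine ⟨(⟨y, hyO⟩, ⟨_, s, s.2, rfl⟩), ?_⟩
    change IsLocalization.mk' K 1 s • y * algebraMap A E s = y
    rw [mul_comm, ← Algebra.smul_def, ← algebraMap_smul K, smul_smul, mul_comm,
      IsLocalization.mk'_spec, map_one, one_smul]
  exists_of_eq h := ⟨1, by rw [Subtype.val_injective h]⟩

theorem exists_basis_eq_coe_and_discr_eq {ι : Type*} [Fintype ι] [DecidableEq ι]
    (hO : Submodule.span K (O : Set E) = ⊤) (b : Module.Basis ι A O) :
    ∃ B : Module.Basis ι K E, (∀ i, B i = b i) ∧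
      Algebra.discr K B = algebraMap A K (Algebra.discr A b) :=
  have := isLocalization_of_span_eq_top hO
  ⟨b.localizationLocalization K A⁰ E, b.localizationLocalization_apply K A⁰ E,
    Algebra.discr_localizationLocalization A A⁰ E b⟩

theorem algebraMap_discr_eq_det_sq_mul_discr {ι : Type*} [Fintype ι] [DecidableEq ι]
    (hO : Submodule.span K (O : Set E) = ⊤) (b : Module.Basis ι A O) (W : Module.Basis ι K E) :
    algebraMap A K (Algebra.discr A b) = W.det (O.val ∘ b) ^ 2 * Algebra.discr K W := by
  obtain ⟨B, hB, hdiscr⟩ := exists_basis_eq_coe_and_discr_eq hO b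
  rw [← hdiscr, W.det_apply, ← Algebra.discr_of_matrix_vecMul, W.toMatrix_map_vecMul]
  exact congrArg (Algebra.discr K) (funext hB)

theorem exists_unit_algebraMap_eq_det [IsIntegrallyClosed A] {ι : Type*} [Fintype ι]
    [DecidableEq ι] (hO : Submodule.span K (O : Set E) = ⊤) (b : Module.Basis ι A O)
    (W : Module.Basis ι K E) {D : A} (hD : D ≠ 0) (hW : Algebra.discr K W = algebraMap A K D)
    (hdiscr : Associated (Algebra.discr A b) D) :
    ∃ d : Aˣ, algebraMap A K d = W.det (O.val ∘ b) := by
  have hinj : Function.Injective (algebraMap A K) := IsFractionRing.injective A K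
  obtain ⟨e, he⟩ := hdiscr.symm
  have hsq : algebraMap A K e = W.det (O.val ∘ b) ^ 2 := by
    refine mul_right_cancel₀ ((map_ne_zero_iff _ hinj).mpr hD) ?_
    rw [← map_mul, mul_comm, he, algebraMap_discr_eq_det_sq_mul_discr hO b W, hW]
  obtain ⟨d, hd⟩ := IsIntegrallyClosed.exists_algebraMap_eq_of_isIntegral_pow (R := A)
    (x := W.det (O.val ∘ b)) two_pos (hsq ▸ isIntegral_algebraMap)
  rw [← hd, ← map_pow, hinj.eq_iff] at hsq
  exact ⟨((isUnit_pow_iff two_ne_zero).mp (hsq ▸ e.isUnit)).unit, hd⟩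

theorem exists_eq_smul_one_add_smul [IsIntegrallyClosed A] (b : Module.Basis (Fin 2) A O)
    {w : E} (hw : IsIntegral A w) (W : Module.Basis (Fin 2) K E) (hW : ⇑W = ![1, w])
    {d : A} (hd : algebraMap A K d = W.det (O.val ∘ b)) (x : O) :
    ∃ p q : A, (x : E) = p • 1 + q • w := by
  have hW0 : W 0 = 1 := congrFun hW 0
  have hW1 : W 1 = w := congrFun hW 1
  have : Nontrivial E := ⟨1, 0, fun h => W.ne_zero 0 (hW0.trans h)⟩
  have : Module.Finite A O := .of_basis b
  have hx : (x : E) = W.repr x 0 • 1 + W.repr x 1 • w := by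
    rw [← hW0, ← hW1, ← Fin.sum_univ_two fun i => W.repr x i • W i, W.sum_repr]
  have hdet : W.repr x 1 = W.det (O.val ∘ ![1, x]) := by
    have h1 : W.repr (1 : E) = Finsupp.single 0 1 := by rw [← hW0, W.repr_self]
    simp [W.det_apply, Matrix.det_fin_two, Module.Basis.toMatrix_apply, h1]
  obtain ⟨q, hq⟩ : ∃ q : A, algebraMap A K q = W.repr x 1 :=
    ⟨d * b.det ![1, x], by
      rw [hdet, map_mul, hd]
      exact (basis_det_comp_linearMap b W O.val.toLinearMap ![1, x]).symm⟩
  obtain ⟨p, hp⟩ : ∃ p : A, algebraMap A K p = W.repr x 0 := by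
    refine IsIntegrallyClosed.isIntegral_iff.mp ?_
    have hsub : algebraMap K E (W.repr x 0) = x - q • w := by
      rw [eq_sub_iff_add_eq, ← algebraMap_smul K, hq, Algebra.algebraMap_eq_smul_one, ← hx]
    rw [← isIntegral_algebraMap_iff (algebraMap K E).injective, hsub]
    exact ((Algebra.IsIntegral.isIntegral (R := A) x).map O.val).sub (hw.smul q)
  exact ⟨p, q, by rw [hx, ← hp, ← hq, algebraMap_smul, algebraMap_smul]⟩

theorem mem_of_isUnit_det [IsIntegrallyClosed A] (b : Module.Basis (Fin 2) A O)
    {w : E} (hw : IsIntegral A w) (W : Module.Basis (Fin 2) K E) (hW : ⇑W = ![1, w])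
    {d : Aˣ} (hd : algebraMap A K d = W.det (O.val ∘ b)) : w ∈ O := by
  have hW0 : W 0 = 1 := congrFun hW 0
  have hW1 : W 1 = w := congrFun hW 1
  choose p q hpq using exists_eq_smul_one_add_smul b hw W hW hd
  have hrepr (x : O) : W.repr x = Finsupp.single 0 (algebraMap A K (p x)) +
      Finsupp.single 1 (algebraMap A K (q x)) := by
    have hx : (x : E) = algebraMap A K (p x) • W 0 + algebraMap A K (q x) • W 1 := by
      rw [hpq x, hW0, hW1, algebraMap_smul, algebraMap_smul]
    rw [hx, map_add, map_smul, map_smul, W.repr_self, W.repr_self, Finsupp.smul_single_one,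
      Finsupp.smul_single_one]
  have hdet : (d : A) = p (b 0) * q (b 1) - p (b 1) * q (b 0) := by
    apply IsFractionRing.injective A K
    rw [hd, W.det_apply, Matrix.det_fin_two]
    simp [Module.Basis.toMatrix_apply, hrepr, mul_comm]
  have hcramer : (d : A) • w = p (b 0) • (b 1 : E) - p (b 1) • (b 0 : E) := by
    rw [hpq (b 0), hpq (b 1), hdet]
    module
  have hmem : (d : A) • w ∈ O :=
    hcramer ▸ O.sub_mem (O.smul_mem (b 1).2 _) (O.smul_mem (b 0).2 _)
  simpa [smul_smul] using O.smul_mem hmem (↑d⁻¹ : A)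

theorem mem_of_associated_discr [IsIntegrallyClosed A] (hO : Submodule.span K (O : Set E) = ⊤)
    (b : Module.Basis (Fin 2) A O) {w : E} (hspan : ⊤ ≤ Submodule.span K (Set.range ![1, w]))
    {u v : A} (hw : w ^ 2 = u • w - v • 1) (hne : u ^ 2 - 4 * v ≠ 0)
    (hdiscr : Associated (Algebra.discr A b) (u ^ 2 - 4 * v)) : w ∈ O := by
  obtain ⟨B, -, -⟩ := exists_basis_eq_coe_and_discr_eq hO b
  let W := basisOfTopLeSpanOfCardEqFinrank ![1, w] hspan
    (Module.finrank_eq_card_basis B).symm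
  have hW : ⇑W = ![1, w] := coe_basisOfTopLeSpanOfCardEqFinrank ..
  have hdiscrW : Algebra.discr K W = algebraMap A K (u ^ 2 - 4 * v) := by
    rw [discr_eq_of_sq_eq W hW (u := algebraMap A K u) (v := algebraMap A K v)
      (by rw [hw, algebraMap_smul, algebraMap_smul])]
    simp only [map_sub, map_pow, map_mul, map_ofNat]
  have hint : IsIntegral A w :=
    ⟨X ^ 2 - (C u * X - C v), monic_X_pow_sub (by compute_degree!), by simp [hw, Algebra.smul_def]⟩
  obtain ⟨d, hd⟩ := exists_unit_algebraMap_eq_det hO b W hne hdiscrW hdiscr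
  exact mem_of_isUnit_det b hint W hW hd

theorem exists_mem_smul_eq_sub_one [IsIntegrallyClosed A] (hO : Submodule.span K (O : Set E) = ⊤)
    (b : Module.Basis (Fin 2) A O) {F : E} (hspan : ⊤ ≤ Submodule.span K (Set.range ![1, F]))
    {c N r u v : A} (hF : F ^ 2 = c • F - N • 1) (hr : r ≠ 0) (hu : c - 2 = r * u)
    (hv : 1 - c + N = r ^ 2 * v) (hne : u ^ 2 - 4 * v ≠ 0)
    (hdiscr : Associated (Algebra.discr A b) (u ^ 2 - 4 * v)) : ∃ w ∈ O, r • w = F - 1 := by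
  have hrK : algebraMap A K r ≠ 0 := (map_ne_zero_iff _ (IsFractionRing.injective A K)).mpr hr
  obtain ⟨w, hrw⟩ : ∃ w : E, algebraMap A K r • w = F - 1 := ⟨_, smul_inv_smul₀ hrK _⟩
  have hw : w ^ 2 = u • w - v • 1 := by
    apply smul_right_injective E (pow_ne_zero 2 hrK)
    have hright : r ^ 2 • (u • w - v • 1) = (c - 2) • (F - 1) - (1 - c + N) • (1 : E) := by
      rw [hu, hv, ← hrw, algebraMap_smul]
      module
    have hleft : (F - 1) ^ 2 = (c - 2) • (F - 1) - (1 - c + N) • (1 : E) := by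
      rw [sub_sq, hF, mul_one, one_pow, two_mul]
      module
    change algebraMap A K r ^ 2 • w ^ 2 = algebraMap A K r ^ 2 • (u • w - v • 1)
    rw [← _root_.smul_pow, hrw, hleft, ← hright, ← map_pow, algebraMap_smul]
  have hwspan : Submodule.span K (Set.range ![1, F]) ≤ Submodule.span K (Set.range ![1, w]) := by
    simp only [Matrix.range_cons, Matrix.range_empty, Set.union_empty, Set.singleton_union]
    rw [← add_sub_cancel 1 F, ← hrw, Submodule.span_le, Set.insert_subset_iff,
      Set.singleton_subset_iff]
    have h1 : (1 : E) ∈ Submodule.span K {1, w} := Submodule.mem_span_of_mem (by simp)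
    exact ⟨h1, add_mem h1 (Submodule.smul_mem _ _ (Submodule.mem_span_of_mem (by simp)))⟩
  exact ⟨w, mem_of_associated_discr hO b (hspan.trans hwspan) hw hne hdiscr,
    (algebraMap_smul K r w).symm.trans hrw⟩

end QuadraticOrder

theorem exists_generator_of_mul_sq_eq_span_discr {R : Type*} [CommRing R] [IsDomain R]
    [IsPrincipalIdealRing R] {c N : R} (hne : c ^ 2 - 4 * N ≠ 0) {ρ D : Ideal R}
    (hsq : 1 - c + N ∈ ρ ^ 2) (hc : c - 2 ∈ ρ) (hD : D * ρ ^ 2 = Ideal.span {c ^ 2 - 4 * N}) :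
    ∃ r u v : R, ρ = Ideal.span {r} ∧ r ≠ 0 ∧ c - 2 = r * u ∧ 1 - c + N = r ^ 2 * v ∧
      u ^ 2 - 4 * v ≠ 0 ∧ D = Ideal.span {u ^ 2 - 4 * v} := by
  obtain ⟨r, rfl⟩ : ∃ r, ρ = Ideal.span {r} := (IsPrincipalIdealRing.principal ρ).principal
  obtain ⟨u, hu⟩ := Ideal.mem_span_singleton.mp hc
  rw [Ideal.span_singleton_pow] at hsq hD
  obtain ⟨v, hv⟩ := Ideal.mem_span_singleton.mp hsq
  have huv : c ^ 2 - 4 * N = (u ^ 2 - 4 * v) * r ^ 2 := by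
    linear_combination (c - 2 + r * u) * hu - 4 * hv
  have hr2 : r ^ 2 ≠ 0 := right_ne_zero_of_mul (huv ▸ hne)
  refine ⟨r, u, v, rfl, pow_ne_zero_iff two_ne_zero |>.mp hr2, hu, hv,
    left_ne_zero_of_mul (huv ▸ hne), ?_⟩
  rw [huv, ← Ideal.span_singleton_mul_span_singleton] at hD
  exact mul_right_cancel₀ (Ideal.span_singleton_eq_bot.not.mpr hr2) hD

namespace Ore

variable {Fq L : Type*} [Field Fq] [Fintype Fq] [Field L] [Algebra Fq L]

theorem induction_monomial {motive : Ore Fq L → Prop} (f : Ore Fq L) (zero : motive 0)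
    (add_monomial : ∀ n a g, motive g → motive (monomial Fq n a + g)) : motive f :=
  SkewPolynomial.induction (R := L) (motive := motive) f zero
    fun n a g _ _ hg => add_monomial n a g hg

omit [Field Fq] [Fintype Fq] [Algebra Fq L] in
theorem ext_coeff {f g : Ore Fq L} (h : ∀ n, f.coeff n = g.coeff n) : f = g :=
  SkewPolynomial.ext_iff.mpr h

theorem coeff_add (f g : Ore Fq L) (n : ℕ) : (f + g).coeff n = f.coeff n + g.coeff n :=
  DFunLike.congr_fun (SkewMonoidAlgebra.coeff_add (k := L) (G := Multiplicative ℕ) f g) _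

theorem coeff_zero (n : ℕ) : (0 : Ore Fq L).coeff n = 0 := rfl

omit [Field Fq] [Fintype Fq] [Algebra Fq L] in
theorem coeff_monomial (m n : ℕ) (a : L) :
    (monomial Fq m a).coeff n = if m = n then a else 0 :=
  SkewPolynomial.coeff_monomial (R := L)

section Action

variable {E E' : Type*} [CommRing E] [Algebra L E] [Algebra Fq E] [CommRing E'] [Algebra L E']
  [Algebra Fq E']

theorem act_add_apply (f g : Ore Fq L) (x : E) :
    act Fq E (f + g) x = act Fq E f x + act Fq E g x :=
  DFunLike.congr_fun (map_add (act Fq E) f g) x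

theorem act_sub_apply (f g : Ore Fq L) (x : E) :
    act Fq E (f - g) x = act Fq E f x - act Fq E g x :=
  DFunLike.congr_fun (map_sub (act Fq E) f g) x

theorem act_mul_apply (f g : Ore Fq L) (x : E) :
    act Fq E (f * g) x = act Fq E f (act Fq E g x) :=
  DFunLike.congr_fun (map_mul (act Fq E) f g) x

theorem act_naturality (φ : E →ₐ[L] E') (f : Ore Fq L) (x : E) :
    act Fq E' f (φ x) = φ (act Fq E f x) := by
  induction f using induction_monomial with
  | zero => simp
  | add_monomial n a g hg =>
    rw [act_add_apply, act_add_apply, map_add, hg, act_monomial, act_monomial, map_smul, map_pow]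

theorem act_frob [Finite L] (x : E) : act Fq E (frob Fq L) x = x ^ Nat.card L := by
  rw [frob, act_monomial, one_smul, Module.natCard_eq_pow_finrank (K := Fq),
    Nat.card_eq_fintype_card]

end Action

/-- The additive polynomial `∑ aᵢ X ^ (q ^ i)` of the Ore polynomial `∑ aᵢ τ ^ i`, obtained by
letting the latter act on `X ∈ L[X]`. -/
noncomputable def addPoly : Ore Fq L →+ L[X] :=
  (AddMonoidHom.eval X).comp (act Fq L[X]).toAddMonoidHom

theorem addPoly_apply (f : Ore Fq L) : addPoly f = act Fq L[X] f X := rfl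

theorem aeval_addPoly {E : Type*} [CommRing E] [Algebra L E] [Algebra Fq E] (f : Ore Fq L)
    (x : E) : aeval x (addPoly f) = act Fq E f x := by
  rw [addPoly_apply, ← act_naturality, aeval_X]

theorem addPoly_monomial (n : ℕ) (a : L) :
    addPoly (monomial Fq n a) = C a * X ^ Fintype.card Fq ^ n := by
  rw [addPoly_apply, act_monomial, smul_eq_C_mul]

theorem addPoly_mul (f g : Ore Fq L) : addPoly (f * g) = (addPoly f).comp (addPoly g) := by
  rw [comp_eq_aeval, aeval_addPoly, addPoly_apply, act_mul_apply, ← addPoly_apply]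

theorem coeff_addPoly (f : Ore Fq L) (n : ℕ) :
    (addPoly f).coeff (Fintype.card Fq ^ n) = f.coeff n := by
  induction f using induction_monomial with
  | zero => rw [map_zero, coeff_zero, Polynomial.coeff_zero]
  | add_monomial m a g hg =>
    rw [map_add, Polynomial.coeff_add, hg, coeff_add, addPoly_monomial, coeff_monomial,
      coeff_C_mul_X_pow]
    simp only [(Nat.pow_right_injective (Fintype.one_lt_card (α := Fq))).eq_iff, eq_comm]

theorem exists_eq_pow_of_coeff_addPoly_ne_zero {f : Ore Fq L} {k : ℕ}
    (hk : (addPoly f).coeff k ≠ 0) : ∃ n, k = Fintype.card Fq ^ n := by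
  contrapose! hk
  induction f using induction_monomial with
  | zero => rw [map_zero, Polynomial.coeff_zero]
  | add_monomial m a g hg =>
    rw [map_add, Polynomial.coeff_add, hg, addPoly_monomial, coeff_C_mul_X_pow, if_neg (hk m),
      add_zero]

theorem natDegree_addPoly_eq {f : Ore Fq L} {n : ℕ} (hn : f.coeff n ≠ 0)
    (h : ∀ m, n < m → f.coeff m = 0) : (addPoly f).natDegree = Fintype.card Fq ^ n := by
  refine natDegree_eq_of_le_of_coeff_ne_zero (natDegree_le_iff_coeff_eq_zero.mpr fun k hk => ?_)
    ((coeff_addPoly f n).trans_ne hn)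
  by_contra hk0
  obtain ⟨m, rfl⟩ := exists_eq_pow_of_coeff_addPoly_ne_zero hk0
  exact hk0 ((coeff_addPoly f m).trans (h m ((Nat.pow_lt_pow_iff_right Fintype.one_lt_card).mp hk)))

theorem addPoly_eq_zero {f : Ore Fq L} : addPoly f = 0 ↔ f = 0 := by
  refine ⟨fun h => ext_coeff fun n => ?_, fun h => h ▸ map_zero addPoly⟩
  rw [← coeff_addPoly, h, coeff_zero, Polynomial.coeff_zero]

theorem mem_rootSet_addPoly {E : Type*} [CommRing E] [IsDomain E] [Algebra L E] [Algebra Fq E]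
    {f : Ore Fq L} (hf : f ≠ 0) {x : E} : x ∈ (addPoly f).rootSet E ↔ act Fq E f x = 0 := by
  rw [mem_rootSet_of_ne (addPoly_eq_zero.not.mpr hf), aeval_addPoly]

instance : NoZeroDivisors (Ore Fq L) where
  eq_zero_or_eq_zero_of_mul_eq_zero {f g} h := by
    have hg : (addPoly g).coeff 0 = 0 := by
      rw [coeff_zero_eq_aeval_zero, aeval_addPoly, map_zero]
    rw [← addPoly_eq_zero, addPoly_mul, comp_eq_zero_iff, hg, C_0, addPoly_eq_zero,
      addPoly_eq_zero] at h
    exact h.imp_right And.right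

theorem derivative_addPoly (f : Ore Fq L) : derivative (addPoly f) = C (f.coeff 0) := by
  induction f using induction_monomial with
  | zero => rw [map_zero, map_zero, coeff_zero, C_0]
  | add_monomial m a g hg =>
    rw [map_add, derivative_add, hg, coeff_add, C_add, addPoly_monomial, coeff_monomial]
    congr 1
    rcases m with _ | m
    · simp
    · have : ((Fintype.card Fq : ℕ) : L) = 0 := by
        rw [← map_natCast (algebraMap Fq L), FiniteField.cast_card_eq_zero, map_zero]
      simp [derivative_X_pow, this]

theorem separable_addPoly {f : Ore Fq L} (h : f.coeff 0 ≠ 0) : (addPoly f).Separable := by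
  rw [Polynomial.Separable, derivative_addPoly]
  exact ⟨0, C (f.coeff 0)⁻¹, by rw [zero_mul, zero_add, ← C_mul, inv_mul_cancel₀ h, C_1]⟩

/-- The constant coefficient `∑ aᵢ τ ^ i ↦ a₀`, as a ring homomorphism `L{τ} → L`. -/
noncomputable def constCoeff : Ore Fq L →+* L where
  toFun f := f.coeff 0
  map_one' := SkewPolynomial.coeff_one_zero (R := L)
  map_mul' f g := by
    have h := derivative_addPoly (f * g)
    rw [addPoly_mul, derivative_comp, derivative_addPoly, derivative_addPoly, C_comp, ← C_mul] at h
    rw [← C_injective h, mul_comm]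
  map_zero' := coeff_zero 0
  map_add' f g := coeff_add f g 0

theorem constCoeff_frob [Finite L] : constCoeff (frob Fq L) = 0 :=
  (coeff_monomial (Fq := Fq) _ _ _).trans (if_neg Module.finrank_pos.ne')

end Ore

theorem map_ne_zero_of_finrank_lt_natDegree {k L : Type*} [Field k] [Field L] [Algebra k L]
    [FiniteDimensional k L] (γ : k[X] →ₐ[k] L) {f : k[X]} (hf : Irreducible f)
    (h : Module.finrank k L < f.natDegree) : γ f ≠ 0 := by
  intro h0
  have hroot : aeval (γ X) f = 0 := by rw [aeval_algHom_apply, aeval_X_left_apply, h0]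
  have hdeg : f.natDegree = (minpoly k (γ X)).natDegree := by
    rw [← minpoly.eq_of_irreducible hf hroot,
      natDegree_mul_C (inv_ne_zero (leadingCoeff_ne_zero.mpr hf.ne_zero))]
  exact (hdeg.trans_le (minpoly.natDegree_le (γ X))).not_gt h

theorem isCoprime_span_ker_of_irreducible {k L : Type*} [Field k] [Field L] [Algebra k L]
    [FiniteDimensional k L] (γ : k[X] →ₐ[k] L) {f : k[X]} (hf : Irreducible f) (h : γ f ≠ 0) :
    IsCoprime (Ideal.span {f}) (RingHom.ker γ) := by
  have hker : RingHom.ker γ ≠ ⊥ := fun hbot =>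
    minpoly.ne_zero_of_finite k (γ X) <| (Submodule.eq_bot_iff _).mp hbot _ <| by
      rw [RingHom.mem_ker, ← aeval_X_left_apply (minpoly k (γ X)), ← aeval_algHom_apply,
        minpoly.aeval]
  refine Ideal.isCoprime_iff_sup_eq.mpr (Ideal.IsMaximal.coprime_of_ne
    (PrincipalIdealRing.isMaximal_of_irreducible hf)
    ((RingHom.ker_isPrime γ).isMaximal hker) fun heq => h ?_)
  exact RingHom.mem_ker.mp (heq ▸ Ideal.mem_span_singleton_self f)

namespace DrinfeldModule

variable {Fq L : Type*} [Field Fq] [Fintype Fq] [Field L] [Algebra Fq L]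
  {γ : Fq[X] →ₐ[Fq] L} (Φ : DrinfeldModule γ)

theorem constCoeff_toRingHom (a : Fq[X]) : Ore.constCoeff (Φ.toRingHom a) = γ a := Φ.coeff_zero a

theorem addPoly_toRingHom_C (a : Fq) :
    Ore.addPoly (Φ.toRingHom (C a)) = C (algebraMap Fq L a) * X := by
  rw [Φ.map_C, Ore.addPoly_monomial, pow_zero, pow_one]

theorem natDegree_addPoly_toRingHom {a : Fq[X]} (ha : a ≠ 0) :
    (Ore.addPoly (Φ.toRingHom a)).natDegree = Fintype.card Fq ^ (2 * a.natDegree) := by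
  induction hd : a.natDegree generalizing a with
  | zero =>
    obtain ⟨x, rfl⟩ := natDegree_eq_zero.mp hd
    rw [addPoly_toRingHom_C, natDegree_C_mul_X, mul_zero, pow_zero]
    simpa using ha
  | succ d ih =>
    have hdiv : a.divX.natDegree = d := by rw [natDegree_divX_eq_natDegree_tsub_one, hd]; rfl
    have hdiv0 : a.divX ≠ 0 := fun h => by
      rw [divX_eq_zero_iff.mp h, natDegree_C] at hd
      exact d.succ_ne_zero hd.symm
    have hcomp : (Ore.addPoly (Φ.toRingHom (a.divX * X))).natDegree =
        Fintype.card Fq ^ (2 * (d + 1)) := by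
      rw [map_mul, Ore.addPoly_mul, natDegree_comp, ih hdiv0 hdiv,
        Ore.natDegree_addPoly_eq Φ.coeff_two_ne_zero Φ.coeff_eq_zero, ← pow_add, mul_add_one]
    have hconst : (Ore.addPoly (Φ.toRingHom (C (a.coeff 0)))).natDegree <
        Fintype.card Fq ^ (2 * (d + 1)) := by
      rw [addPoly_toRingHom_C]
      exact (natDegree_C_mul_le _ _).trans_lt
        (natDegree_X_le.trans_lt (Nat.one_lt_pow (by lia) Fintype.one_lt_card))
    conv_lhs => rw [← divX_mul_X_add a, map_add, map_add]
    rw [natDegree_add_eq_left_of_natDegree_lt (hcomp ▸ hconst), hcomp]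

theorem toRingHom_ne_zero {a : Fq[X]} (ha : a ≠ 0) : Φ.toRingHom a ≠ 0 := by
  intro h
  have hdeg := Φ.natDegree_addPoly_toRingHom ha
  rw [h, map_zero, natDegree_zero] at hdeg
  exact (pow_pos Fintype.card_pos _).ne hdeg

instance : Module.IsTorsionFree Fq[X] Φ.endRing :=
  .of_smul_eq_zero fun a f h => by
    rw [Algebra.smul_def, mul_eq_zero] at h
    exact h.imp_left fun h => not_not.mp fun ha =>
      Φ.toRingHom_ne_zero ha (congrArg Subtype.val h)

section Points

variable {E E' : Type*} [CommRing E] [Algebra L E] [Algebra Fq E] [CommRing E'] [Algebra L E']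
  [Algebra Fq E']

instance [Finite E] : Finite (Φ.Points E) := inferInstanceAs (Finite E)

/-- The `A`-linear map that a homomorphism `E → E'` of `L`-algebras induces on the points of
`Φ`. -/
noncomputable def pointsMap (φ : E →ₐ[L] E') : Φ.Points E →ₗ[Fq[X]] Φ.Points E' where
  toFun x := φ x
  map_add' := map_add φ
  map_smul' a x := (Ore.act_naturality φ (Φ.toRingHom a) x).symm

/-- Endomorphisms of `Φ` act on its points by `f • x = f(x)`. -/
noncomputable instance : Module Φ.endRing (Φ.Points E) :=
  letI : Module (AddMonoid.End E) (Φ.Points E) := inferInstanceAs (Module (AddMonoid.End E) E)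
  Module.compHom (Φ.Points E) ((Ore.act Fq E).comp Φ.endRing.subtype)

instance : IsScalarTower Fq[X] Φ.endRing (Φ.Points E) where
  smul_assoc a f x := Ore.act_mul_apply (Φ.toRingHom a) (f : Ore Fq L) (show E from x)

theorem frob_smul [Finite L] (x : Φ.Points E) : Φ.frob • x = Φ.frobPoints E x := rfl

end Points

section Torsion

variable {Φ}

theorem mem_torsion_span {a : Fq[X]} {x : Φ.Points (AlgebraicClosure L)} :
    x ∈ Φ.torsion (Ideal.span {a}) ↔ a • x = 0 := by
  rw [torsion, Submodule.torsionBySet_span_singleton_eq, Submodule.mem_torsionBy_iff]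

variable (Φ)

theorem natCard_torsion {a : Fq[X]} (ha : γ a ≠ 0) :
    Nat.card (Φ.torsion (Ideal.span {a})) = Fintype.card Fq ^ (2 * a.natDegree) := by
  have ha0 : a ≠ 0 := fun h => ha (h ▸ map_zero γ)
  have hsep : (Ore.addPoly (Φ.toRingHom a)).Separable :=
    Ore.separable_addPoly ((Φ.coeff_zero a).trans_ne ha)
  rw [← Φ.natDegree_addPoly_toRingHom ha0, ← card_rootSet_eq_natDegree (K := AlgebraicClosure L)
    hsep (IsAlgClosed.splits _), ← Nat.card_eq_fintype_card]
  refine Nat.card_congr (Equiv.subtypeEquivRight fun x => ?_)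
  exact mem_torsion_span.trans (Ore.mem_rootSet_addPoly (E := AlgebraicClosure L) (x := x)
    (Φ.toRingHom_ne_zero ha0)).symm

variable {Φ}

theorem eq_zero_of_act_torsion_eq_zero {a : Fq[X]} (ha : γ a ≠ 0) {f : Ore Fq L}
    (hf : ∀ x ∈ Φ.torsion (Ideal.span {a}), Ore.act Fq (AlgebraicClosure L) f x = 0)
    (hdeg : (Ore.addPoly f).natDegree < Fintype.card Fq ^ (2 * a.natDegree)) : f = 0 := by
  by_contra hf0
  refine hdeg.not_ge ?_
  calc Fintype.card Fq ^ (2 * a.natDegree)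
      = Nat.card (Φ.torsion (Ideal.span {a})) := (Φ.natCard_torsion ha).symm
    _ ≤ ((Ore.addPoly f).rootSet (AlgebraicClosure L)).ncard :=
        Nat.card_mono (rootSet_finite (Ore.addPoly f) (AlgebraicClosure L)) fun x hx =>
          (Ore.mem_rootSet_addPoly (E := AlgebraicClosure L) hf0).mpr (hf x hx)
    _ ≤ (Ore.addPoly f).natDegree := ncard_rootSet_le _ _

variable (Φ)

theorem nonempty_basis_torsion {a : Fq[X]} (ha : Irreducible a) (hγ : γ a ≠ 0) :
    Nonempty (Module.Basis (Fin 2) (Fq[X] ⧸ Ideal.span {a}) (Φ.torsion (Ideal.span {a}))) := by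
  have : (Ideal.span {a}).IsMaximal := PrincipalIdealRing.isMaximal_of_irreducible ha
  let _ : Field (Fq[X] ⧸ Ideal.span {a}) := Ideal.Quotient.field _
  have hcard := Φ.natCard_torsion hγ
  have : Finite (Φ.torsion (Ideal.span {a})) :=
    Nat.finite_of_card_ne_zero (hcard.trans_ne (pow_pos Fintype.card_pos _).ne')
  rw [Module.natCard_eq_pow_finrank (K := Fq[X] ⧸ Ideal.span {a}),
    natCard_quotient_span_singleton ha.ne_zero, ← pow_mul, Nat.card_eq_fintype_card,
    (Nat.pow_right_injective (Fintype.one_lt_card (α := Fq))).eq_iff, mul_comm,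
    Nat.mul_left_inj ha.natDegree_pos.ne'] at hcard
  exact ⟨Module.finBasisOfFinrankEq _ _ hcard⟩

end Torsion

section Frobenius

variable [Finite L] {Φ} {c N : Fq[X]}

theorem frob_sq_sub_smul {E : Type*} [CommRing E] [Algebra L E] [Algebra Fq E]
    (x : Φ.Points E) : (Φ.frob ^ 2 - (c • Φ.frob - N • 1)) • x =
      Φ.frobPoints E (Φ.frobPoints E x) - (c • Φ.frobPoints E x - N • x) := by
  simp only [sub_smul, pow_two, mul_smul, smul_assoc, one_smul, frob_smul]

theorem IsFrobCharpoly.frobPoints_frobPoints (h : Φ.IsFrobCharpoly (X ^ 2 - C c * X + C N))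
    {I : Ideal Fq[X]} (hI : IsCoprime I (RingHom.ker γ))
    (b : Module.Basis (Fin 2) (Fq[X] ⧸ I) (Φ.torsion I)) {x : Φ.Points (AlgebraicClosure L)}
    (hx : x ∈ Φ.torsion I) :
    Φ.frobPoints _ (Φ.frobPoints _ x) = c • Φ.frobPoints _ x - N • x := by
  have : Module.Free (Fq[X] ⧸ I) (Φ.torsion I) := .of_basis b
  have : Module.Finite (Fq[X] ⧸ I) (Φ.torsion I) := .of_basis b
  have hCH := LinearMap.aeval_self_charpoly (Φ.frobTorsion I)
  rw [← LinearMap.charpoly_toMatrix _ b, h I hI b] at hCH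
  simp only [Polynomial.map_add, Polynomial.map_sub, Polynomial.map_mul, Polynomial.map_pow,
    map_X, Polynomial.map_C, map_add, map_sub, map_mul, map_pow, aeval_X, aeval_C] at hCH
  have hCHx := congrArg Subtype.val (LinearMap.congr_fun hCH ⟨x, hx⟩)
  rw [pow_two] at hCHx
  rw [← sub_eq_zero, ← sub_add]
  exact hCHx

/-- An endomorphism killing `Φ[l]` is zero once `deg l` is large, so the Cayley–Hamilton relation
on the torsion lifts to `End_L Φ`. -/
theorem IsFrobCharpoly.frob_sq (h : Φ.IsFrobCharpoly (X ^ 2 - C c * X + C N)) :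
    Φ.frob ^ 2 = c • Φ.frob - N • 1 := by
  let g : Ore Fq L := (Φ.frob ^ 2 - (c • Φ.frob - N • 1) : Φ.endRing)
  obtain ⟨l, hl, hdeg⟩ := exists_irreducible_natDegree_eq Fq
    (Nat.succ_ne_zero (Module.finrank Fq L + (Ore.addPoly g).natDegree))
  have hγ : γ l ≠ 0 := map_ne_zero_of_finrank_lt_natDegree γ hl (by lia)
  obtain ⟨b⟩ := Φ.nonempty_basis_torsion hl hγ
  have hker (x) (hx : x ∈ Φ.torsion (Ideal.span {l})) :
      Ore.act Fq (AlgebraicClosure L) g x = 0 := by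
    have hrel := h.frobPoints_frobPoints (isCoprime_span_ker_of_irreducible γ hl hγ) b hx
    exact (frob_sq_sub_smul x).trans (sub_eq_zero.mpr hrel)
  have hg : g = 0 := eq_zero_of_act_torsion_eq_zero hγ hker <|
    (Nat.lt_pow_self Fintype.one_lt_card).trans_le (Nat.pow_le_pow_right Fintype.card_pos (by lia))
  exact sub_eq_zero.mp (Subtype.ext hg)

theorem map_eq_zero_of_frob_sq (h : Φ.frob ^ 2 = c • Φ.frob - N • 1) : γ N = 0 := by
  have h0 : Ore.frob Fq L ^ 2 = Φ.toRingHom c * Ore.frob Fq L - Φ.toRingHom N * 1 :=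
    congrArg Subtype.val h
  simpa [Ore.constCoeff_frob, constCoeff_toRingHom] using congrArg Ore.constCoeff h0

theorem frobPoints_frobPoints_of_frob_sq (h : Φ.frob ^ 2 = c • Φ.frob - N • 1) {E : Type*}
    [CommRing E] [Algebra L E] [Algebra Fq E] (x : Φ.Points E) :
    Φ.frobPoints _ (Φ.frobPoints _ x) = c • Φ.frobPoints _ x - N • x := by
  rw [← sub_eq_zero, ← frob_sq_sub_smul, h, sub_self, zero_smul]

variable (Φ) in
theorem frobPoints_injective (E : Type*) [CommRing E] [IsReduced E] [Algebra L E] [Algebra Fq E] :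
    Function.Injective (Φ.frobPoints E) :=
  (injective_iff_map_eq_zero _).mpr fun x hx =>
    (pow_eq_zero_iff (M₀ := E) Nat.card_pos.ne').mp
      ((Ore.act_frob (Fq := Fq) (E := E) x).symm.trans hx)

theorem IsOrdinary.discr_ne_zero (hord : Φ.IsOrdinary) (h : Φ.frob ^ 2 = c • Φ.frob - N • 1) :
    c ^ 2 - 4 * N ≠ 0 := by
  intro hΔ
  have hN : γ N = 0 := map_eq_zero_of_frob_sq h
  have hc : γ c = 0 := by
    rw [← pow_eq_zero_iff two_ne_zero, ← map_pow, sub_eq_zero.mp hΔ, map_mul, hN, mul_zero]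
  refine hord (eq_bot_iff.mpr fun x hx => ?_)
  rw [Submodule.mem_torsionBySet_iff] at hx
  have hFF : Φ.frobPoints _ (Φ.frobPoints _ x) = 0 := by
    rw [frobPoints_frobPoints_of_frob_sq h, ← map_smul, hx ⟨c, hc⟩, hx ⟨N, hN⟩, map_zero, sub_zero]
  have hinj := Φ.frobPoints_injective (AlgebraicClosure L)
  exact (map_eq_zero_iff _ hinj).mp ((map_eq_zero_iff _ hinj).mp hFF)

end Frobenius

section FrobField

theorem endToEndK_injective : Function.Injective Φ.endToEndK :=
  Algebra.TensorProduct.includeRight_injective (IsFractionRing.injective _ _)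

variable [Finite L]

/-- The Frobenius `F` as an element of the field `K(F)`. -/
noncomputable def fieldFrob : Φ.FrobField := ⟨Φ.endToEndK Φ.frob, Algebra.subset_adjoin rfl⟩

theorem fieldToEndK_fieldFrob : Φ.fieldToEndK Φ.fieldFrob = Φ.endToEndK Φ.frob := rfl

theorem fieldToEndK_smul (a : Fq[X]) (x : Φ.FrobField) :
    Φ.fieldToEndK (a • x) = a • Φ.fieldToEndK x := rfl

theorem adjoin_fieldFrob : Algebra.adjoin (FractionRing Fq[X]) {Φ.fieldFrob} = ⊤ := by
  refine (congrArg (Algebra.adjoin (FractionRing Fq[X])) (Set.ext fun x => ?_)).trans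
    (Algebra.adjoin_adjoin_coe_preimage (s := {Φ.endToEndK Φ.frob}))
  exact Subtype.ext_iff

variable {Φ} {c N : Fq[X]}

theorem fieldFrob_sq (h : Φ.frob ^ 2 = c • Φ.frob - N • 1) :
    Φ.fieldFrob ^ 2 = c • Φ.fieldFrob - N • 1 := by
  apply Subtype.val_injective
  have h' := congrArg Φ.endToEndK h
  rw [map_pow, map_sub, map_smul, map_smul, map_one] at h'
  exact h'

theorem top_le_span_one_fieldFrob (h : Φ.frob ^ 2 = c • Φ.frob - N • 1) :
    ⊤ ≤ Submodule.span (FractionRing Fq[X]) (Set.range ![1, Φ.fieldFrob]) := by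
  let p : (FractionRing Fq[X])[X] := X ^ 2 - (C (algebraMap _ _ c) * X - C (algebraMap _ _ N))
  have hp : p.Monic := monic_X_pow_sub (by compute_degree!)
  have hp2 : p.natDegree = 2 := by
    simp only [p]
    compute_degree!
  have hroot : aeval Φ.fieldFrob p = 0 := by
    simp [p, fieldFrob_sq h, Algebra.smul_def, ← IsScalarTower.algebraMap_apply]
  have hspan := Submodule.span_range_natDegree_eq_adjoin hp hroot
  rw [adjoin_fieldFrob, Algebra.top_toSubmodule] at hspan
  refine hspan.ge.trans (Submodule.span_mono (Eq.subset ?_))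
  simp [hp2, Finset.range_add_one, Set.pair_comm]

theorem exists_mul_toRingHom_eq_frob_sub_one (h : Φ.frob ^ 2 = c • Φ.frob - N • 1)
    {r u v : Fq[X]} (hr : r ≠ 0) (hu : c - 2 = r * u) (hv : 1 - c + N = r ^ 2 * v)
    (hne : u ^ 2 - 4 * v ≠ 0) {O : Subalgebra Fq[X] Φ.FrobField} (hO : Φ.IsOrder O)
    (hD : Φ.HasDiscr O (Ideal.span {u ^ 2 - 4 * v})) (hEnd : Φ.ContainedInEnd O) :
    ∃ f : Ore Fq L, f * Φ.toRingHom r = Ore.frob Fq L - 1 := by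
  obtain ⟨b, hb⟩ := hD
  obtain ⟨w, hwO, hw⟩ := exists_mem_smul_eq_sub_one hO.2 b (top_le_span_one_fieldFrob h)
    (fieldFrob_sq h) hr hu hv hne (Ideal.span_singleton_eq_span_singleton.mp hb.symm)
  obtain ⟨f, hf⟩ := hEnd w hwO
  have hfr : r • f = Φ.frob - 1 := by
    apply Φ.endToEndK_injective
    rw [map_smul, hf, ← fieldToEndK_smul, hw, map_sub, map_sub, map_one, map_one,
      fieldToEndK_fieldFrob]
  rw [Algebra.smul_def, Algebra.commutes] at hfr
  exact ⟨f, congrArg Subtype.val hfr⟩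

end FrobField

section Cyclic

variable [Finite L] {Φ} {f : Ore Fq L} {a : Fq[X]}

theorem map_ne_zero_of_mul_toRingHom_eq_frob_sub_one
    (hf : f * Φ.toRingHom a = Ore.frob Fq L - 1) : γ a ≠ 0 := by
  intro ha
  have h := congrArg Ore.constCoeff hf
  rw [map_mul, constCoeff_toRingHom, ha, mul_zero, map_sub, Ore.constCoeff_frob, map_one] at h
  exact zero_ne_one (sub_eq_zero.mp h.symm)

theorem pow_natCard_eq_of_act_eq_zero {E : Type*} [CommRing E] [Algebra L E] [Algebra Fq E]
    (hf : f * Φ.toRingHom a = Ore.frob Fq L - 1) {x : E}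
    (hx : Ore.act Fq E (Φ.toRingHom a) x = 0) : x ^ Nat.card L = x := by
  have h := Ore.act_mul_apply f (Φ.toRingHom a) x
  rw [hf, hx, map_zero, Ore.act_sub_apply, Ore.act_frob, map_one] at h
  exact sub_eq_zero.mp h

theorem torsion_subset_image_pointsMap (hf : f * Φ.toRingHom a = Ore.frob Fq L - 1) :
    (Φ.torsion (Ideal.span {a}) : Set (Φ.Points (AlgebraicClosure L))) ⊆
      Φ.pointsMap (Algebra.ofId L (AlgebraicClosure L)) ''
        Submodule.torsionBy Fq[X] (Φ.Points L) a := by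
  intro x hx
  have hax : a • x = 0 := mem_torsion_span.mp hx
  obtain ⟨y, hy⟩ := mem_range_algebraMap_of_pow_natCard_eq (E := AlgebraicClosure L)
    (pow_natCard_eq_of_act_eq_zero hf hax)
  let φ := Φ.pointsMap (Algebra.ofId L (AlgebraicClosure L))
  have hφ : φ y = x := hy
  refine ⟨y, (map_eq_zero_iff φ (algebraMap L (AlgebraicClosure L)).injective).mp ?_, hφ⟩
  exact (φ.map_smul a y).trans (hφ.symm ▸ hax)

theorem natCard_torsion_le (hf : f * Φ.toRingHom a = Ore.frob Fq L - 1) :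
    Nat.card (Φ.torsion (Ideal.span {a})) ≤
      Nat.card (Submodule.torsionBy Fq[X] (Φ.Points L) a) :=
  (Nat.card_mono (Set.toFinite _) (torsion_subset_image_pointsMap hf)).trans
    (Nat.card_image_le (Set.toFinite _))

theorem not_isPrincipal_of_mul_toRingHom_eq_frob_sub_one
    (hf : f * Φ.toRingHom a = Ore.frob Fq L - 1) (ha : ¬IsUnit a) :
    ¬(⊤ : Submodule Fq[X] (Φ.Points L)).IsPrincipal := by
  intro hcyc
  have hγ : γ a ≠ 0 := map_ne_zero_of_mul_toRingHom_eq_frob_sub_one hf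
  have ha0 : a ≠ 0 := fun h => hγ (h ▸ map_zero γ)
  have hcard := natCard_quotient_span_singleton ha0
  rw [Nat.card_eq_fintype_card (α := Fq)] at hcard
  have : Finite (Fq[X] ⧸ Ideal.span {a}) :=
    Nat.finite_of_card_ne_zero (hcard.trans_ne (pow_pos Fintype.card_pos _).ne')
  have hle : Fintype.card Fq ^ (2 * a.natDegree) ≤ Fintype.card Fq ^ a.natDegree := calc
    _ = Nat.card (Φ.torsion (Ideal.span {a})) := (Φ.natCard_torsion hγ).symm
    _ ≤ Nat.card (Submodule.torsionBy Fq[X] (Φ.Points L) a) := natCard_torsion_le hf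
    _ ≤ Nat.card (Fq[X] ⧸ Ideal.span {a}) := natCard_torsionBy_le_of_isPrincipal hcyc a
    _ = Fintype.card Fq ^ a.natDegree := hcard
  rw [Nat.pow_le_pow_iff_right Fintype.one_lt_card] at hle
  have hdeg := natDegree_pos_iff_degree_pos.mpr (degree_pos_of_ne_zero_of_nonunit ha0 ha)
  lia

end Cyclic

end DrinfeldModule

theorem corollary2p1_general {Fq L : Type*} [Field Fq] [Fintype Fq] [Field L] [Finite L]
    [Algebra Fq L] (γ : Fq[X] →ₐ[Fq] L) (Φ : DrinfeldModule γ)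
    (c N : Fq[X]) (hchar : Φ.IsFrobCharpoly (X ^ 2 - C c * X + C N)) (hΔ : c ^ 2 - 4 * N ≠ 0)
    (ρ : Ideal Fq[X]) (hρ : ρ ≠ ⊤)
    (hρ1 : (X ^ 2 - C c * X + C N : Fq[X][X]).eval 1 ∈ ρ ^ 2) (hρ2 : c - 2 ∈ ρ)
    (O : Subalgebra Fq[X] Φ.FrobField) (hO : Φ.IsOrder O)
    (D : Ideal Fq[X]) (hD : Φ.HasDiscr O D) (hDρ : D * ρ ^ 2 = Ideal.span {c ^ 2 - 4 * N})
    (hEnd : Φ.ContainedInEnd O) :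
    ¬ (⊤ : Submodule Fq[X] (Φ.Points L)).IsPrincipal := by
  have heval : 1 - c + N ∈ ρ ^ 2 := by simpa using hρ1
  obtain ⟨r, u, v, rfl, hr, hu, hv, hne, rfl⟩ :=
    exists_generator_of_mul_sq_eq_span_discr hΔ heval hρ2 hDρ
  obtain ⟨f, hf⟩ := DrinfeldModule.exists_mul_toRingHom_eq_frob_sub_one
    hchar.frob_sq hr hu hv hne hO hD hEnd
  exact DrinfeldModule.not_isPrincipal_of_mul_toRingHom_eq_frob_sub_one hf
    (mt Ideal.span_singleton_eq_top.mpr hρ)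

theorem corollary2p1 {Fq L : Type*} [Field Fq] [Fintype Fq] [Field L] [Finite L] [Algebra Fq L]
    (γ : Fq[X] →ₐ[Fq] L) (Φ : DrinfeldModule γ) (hord : Φ.IsOrdinary)
    (c N : Fq[X]) (hchar : Φ.IsFrobCharpoly (X ^ 2 - C c * X + C N))
    (ρ : Ideal Fq[X]) (hρ : ρ ≠ ⊤) (hρP : ρ ≠ RingHom.ker γ)
    (hρ1 : (X ^ 2 - C c * X + C N : Fq[X][X]).eval 1 ∈ ρ ^ 2) (hρ2 : c - 2 ∈ ρ)
    (O : Subalgebra Fq[X] Φ.FrobField) (hO : Φ.IsOrder O)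
    (D : Ideal Fq[X]) (hD : Φ.HasDiscr O D) (hDρ : D * ρ ^ 2 = Ideal.span {c ^ 2 - 4 * N})
    (hEnd : Φ.ContainedInEnd O) :
    ¬ (⊤ : Submodule Fq[X] (Φ.Points L)).IsPrincipal :=
  corollary2p1_general γ Φ c N hchar (hord.discr_ne_zero hchar.frob_sq) ρ hρ hρ1 hρ2 O hO D hD hDρ
    hEnd
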